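/- A probabilistic weighted automaton over a finite alphabet $\Sigma$ consists of a finite set $Q$ of states, an initial probability distribution $\rho_I$ on $Q$, a probability distribution $\delta(q,\sigma)$ on $Q$ for all $q\in Q$, $\sigma\in\Sigma$, and a weight function $\gamma:Q\times\Sigma\times Q\to\mathbb{Q}$. It is deterministic if $\rho_I$ and all $\delta(q,\sigma)$ are point masses. A run over $w=\sigma_1\sigma_2\cdots\in\Sigma^\omega$ is a sequence $q_0\sigma_1q_1\sigma_2\cdots$ with $\rho_I(q_0)>0$ and $\delta(q_i,\sigma_{i+1})(q_{i+1})>0$ for all $i\ge 0$; write $\gamma(r)=v_0v_1\cdots$ with $v_i=\gamma(q_i,\sigma_{i+1},q_{i+1})$ for its weights. Let $\mathbb{P}^A$ be the probability measure on the runs over $w$ with $\mathbb{P}^A(q_0\sigma_1\cdots\sigma_kq_k)=\rho_I(q_0)\prod_{i=1}^{k}\delta(q_{i-1},\sigma_i)(q_i)$. Put $\mathsf{LimAvg}(v)=\liminf_{n\to\infty}\frac1n\sum_{i=0}^{n-1}v_i$. An AsLimAvg automaton is such an automaton $A$ with the almost-sure language $$L_A^{=1}(w)=\sup\{\eta\in\mathbb{R}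 : \mathbb{P}^A(\{r : \mathsf{LimAvg}(\gamma(r))\ge\eta\})=1\}.$$ A DLimAvg automaton is a deterministic one, with language $w\mapsto\sup\{\mathsf{LimAvg}(\gamma(r)) : r \text{ a run over } w\}$. AsLimAvg is closed under sum if for every finite alphabet $\Sigma$ and all $L,L':\Sigma^\omega\to\mathbb{R}$ that are languages of AsLimAvg automata, so is the pointwise sum $L+L'$. **Lemma.** Let $\Sigma=\{a,b\}$ and, for $\sigma\in\Sigma$, let $L_\sigma(w)=\liminf_{n\to\infty}\frac1n\,|\{1\le i\le n : \sigma_i=\sigma\}|$ be the long-run average number of $\sigma$'s in $w=\sigma_1\sigma_2\cdots$. 1. $L_a$ and $L_b$ are languages of DLimAvg automata and also of AsLimAvg automata. 2. $L_a+L_b$ is not the language of any AsLimAvg automaton. 3. Consequently, AsLimAvg is not closed under sum. 4. Quantitatively: if $A$ is an AsLimAvg automaton over $\{a,b\}$ with $L^{=1}_A(u\,a^\omega)=L^{=1}_A(u\,b^\omega)=1$ for every finite word $u$ (these are the values of $L_a+L_b$ on such words), then there is a word $w\in\{a,b\}^\omega$ with $L_a(w)=L_b(w)=0$ and $L^{=1}_A(w)\ge\frac16$.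 -/

import Mathlib

open MeasureTheory ProbabilityTheory Filter Finset

/-- Infinite words over the alphabet `S`; the letter read at step `n` (from `0`) is `w n`. -/
abbrev InfWord (S : Type) : Type := ℕ → S

/-- Quantitative languages over the alphabet `S`. -/
abbrev QuantLang (S : Type) : Type := InfWord S → ℝ

/-- The limit-average value of a sequence of rational numbers. -/
noncomputable def limAvg (v : ℕ → ℚ) : ℝ :=
  liminf (fun n : ℕ => (1 / (n : ℝ)) * ∑ i ∈ range n, (v i : ℝ)) atTop

/-- Probabilistic weighted automata over the alphabet `S`: a finite set of states, an initial
distribution, a probabilistic transition function and a rational weight function. -/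
structure ProbWeightedAutomaton (S : Type) where
  /-- the set of states -/
  State : Type
  /-- the set of states is finite -/
  [finiteState : Finite State]
  /-- the initial distribution -/
  init : PMF State
  /-- the probabilistic transition function -/
  step : State → S → PMF State
  /-- the weight function -/
  weight : State → S → State → ℚ

namespace ProbWeightedAutomaton

variable {S : Type} (A : ProbWeightedAutomaton S)

instance instFiniteState : Finite A.State := A.finiteState

instance instMeasurableSpaceState : MeasurableSpace A.State := ⊤

instance instDiscreteMeasurableSpaceState : DiscreteMeasurableSpace A.State := ⟨fun _ => trivial⟩

/-- The state sequences of the runs of `A` over the infinite word `w`; the letters of a run are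
those of `w`. -/
def runs (w : InfWord S) : Set (ℕ → A.State) :=
  {r | 0 < A.init (r 0) ∧ ∀ i, 0 < A.step (r i) (w i) (r (i + 1))}

/-- The sequence of weights along a run over `w`. -/
def weights (w : InfWord S) (r : ℕ → A.State) : ℕ → ℚ :=
  fun i => A.weight (r i) (w i) (r (i + 1))

/-- Given the states up to time `n`, the law of the state at time `n + 1` when reading `w`. -/
noncomputable def stepKernel (w : InfWord S) (n : ℕ) :
    Kernel (Π _ : Iic n, A.State) A.State :=
  Kernel.ofFunOfCountable fun h => (A.step (h ⟨n, mem_Iic.2 le_rfl⟩) (w n)).toMeasure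

instance instIsMarkovKernelStepKernel (w : InfWord S) (n : ℕ) :
    IsMarkovKernel (A.stepKernel w n) :=
  ⟨fun h => by
    change IsProbabilityMeasure (A.step (h ⟨n, mem_Iic.2 le_rfl⟩) (w n)).toMeasure
    infer_instance⟩

/-- The probability measure on infinite state sequences that `A` induces on the word `w`. -/
noncomputable def runMeasure (w : InfWord S) : Measure (ℕ → A.State) :=
  Kernel.trajMeasure (X := fun _ => A.State) A.init.toMeasure (A.stepKernel w)

/-- The measure is the one determined by the probabilities of the finite runs. -/
theorem runMeasure_cylinder (w : InfWord S) (p : ℕ → A.State) (k : ℕ) :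
    A.runMeasure w {r | ∀ i ≤ k, r i = p i} =
      A.init (p 0) * ∏ i ∈ range k, A.step (p i) (w i) (p (i + 1)) := by
  have hmeas (k : ℕ) : {r : ℕ → A.State | ∀ i ≤ k, r i = p i} =
      Preorder.frestrictLe (π := fun _ => A.State) k ⁻¹' {fun i : Iic k => p i} := by
    ext r
    simp [funext_iff, Preorder.frestrictLe]
  induction k with
  | zero =>
    have hk : (A.runMeasure w).map (Preorder.frestrictLe (π := fun _ => A.State) 0) =
        A.init.toMeasure.map (MeasurableEquiv.piUnique (fun _ : Iic 0 => A.State)).symm := by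
      rw [runMeasure, Kernel.trajMeasure, Measure.map_comp _ _ (by fun_prop),
        Kernel.traj_map_frestrictLe, Kernel.partialTraj_self, Measure.id_comp]
    rw [hmeas, ← Measure.map_apply (by fun_prop) (measurableSet_singleton _), hk,
      Measure.map_apply (by fun_prop) (measurableSet_singleton _)]
    have : (MeasurableEquiv.piUnique (fun _ : Iic 0 => A.State)).symm ⁻¹' {fun i : Iic 0 => p i} =
        {p 0} := by
      ext q
      simp only [Set.mem_preimage, Set.mem_singleton_iff]
      rw [MeasurableEquiv.symm_apply_eq]
      rfl
    rw [this, PMF.toMeasure_apply_singleton _ _ (measurableSet_singleton _)]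
    simp
  | succ k ih =>
    have hset : {r : ℕ → A.State | ∀ i ≤ k + 1, r i = p i} =
        (fun x => (Preorder.frestrictLe (π := fun _ => A.State) k x, x (k + 1))) ⁻¹'
          ({fun i : Iic k => p i} ×ˢ {p (k + 1)}) := by
      ext r
      simp only [Set.mem_ofPred_eq, Set.mem_preimage, Set.mem_prod, Set.mem_singleton_iff]
      constructor
      · exact fun h => ⟨funext fun i => h i ((mem_Iic.1 i.2).trans k.le_succ), h _ le_rfl⟩
      · rintro ⟨h, h'⟩ i hi
        rcases Nat.le_succ_iff.1 hi with hi | rfl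
        · exact congrFun h ⟨i, mem_Iic.2 hi⟩
        · exact h'
    rw [hset, ← Measure.map_apply (by fun_prop)
      ((measurableSet_singleton _).prod (measurableSet_singleton _)), runMeasure,
      ← Kernel.map_frestrictLe_trajMeasure_compProd_eq_map_trajMeasure,
      Measure.compProd_apply_prod (measurableSet_singleton _) (measurableSet_singleton _),
      lintegral_singleton, Measure.map_apply (by fun_prop) (measurableSet_singleton _),
      ← hmeas, ← runMeasure, ih, prod_range_succ, mul_comm, ← mul_assoc]
    congr 1
    exact PMF.toMeasure_apply_singleton _ _ (measurableSet_singleton _)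

/-- The language of the probabilistic limit-average automaton `A` in the almost-sure semantics. -/
noncomputable def asLimAvg : QuantLang S := fun w =>
  sSup {η : ℝ | A.runMeasure w {r | r ∈ A.runs w ∧ η ≤ limAvg (A.weights w r)} = 1}

/-- The language of `A` as a non-probabilistic limit-average automaton: the maximal value of the
runs. -/
noncomputable def maxLimAvg : QuantLang S := fun w =>
  sSup {x : ℝ | ∃ r ∈ A.runs w, x = limAvg (A.weights w r)}

/-- Deterministic automata: the initial distribution and all transitions are point masses. -/
def IsDeterministic : Prop :=
  (∃ q, A.init q = 1) ∧ ∀ q σ, ∃ q', A.step q σ q' = 1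

end ProbWeightedAutomaton

/-- `L` is the language of some limit-average automaton in the almost-sure semantics. -/
def IsAsLimAvg {S : Type} (L : QuantLang S) : Prop :=
  ∃ A : ProbWeightedAutomaton S, A.asLimAvg = L

/-- `L` is the language of some deterministic limit-average automaton. -/
def IsDLimAvg {S : Type} (L : QuantLang S) : Prop :=
  ∃ A : ProbWeightedAutomaton S, A.IsDeterministic ∧ A.maxLimAvg = L

/-- A class of quantitative languages over finite alphabets is closed under sum. -/
def ClosedUnderSum (C : ∀ S : Type, QuantLang S → Prop) : Prop :=
  ∀ (S : Type) [Finite S] (L L' : QuantLang S), C S L → C S L' → C S (L + L')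

/-- The alphabet `{a, b}`. -/
inductive Letter : Type where
  | a : Letter
  | b : Letter
  deriving DecidableEq

instance instFiniteLetter : Finite Letter :=
  Finite.of_injective (fun σ => decide (σ = Letter.a)) fun σ τ h => by
    cases σ <;> cases τ <;> simp_all

/-- The language that assigns to a word over `{a, b}` the long-run average number of occurrences
of the letter `σ`. -/
noncomputable def freqLang (σ : Letter) : QuantLang Letter := fun w =>
  limAvg fun i => if w i = σ then 1 else 0

/-- The infinite word `u σ σ σ …`. -/
def appendConst {S : Type} (u : List S) (σ : S) : InfWord S := fun n => u.getD n σ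

/-!
Let `A` have value at least `c` on every word `u σ σ σ …`, and let `c' < c` and `δ > 0`. There is a
constant `K` such that, whenever `A` reads a block of equal letters inside any word, its weights on
the block fall short of the average `c'` by more than `K` with probability at most `δ`: by the
Markov property this only concerns the states in which the block can begin, and from each of these
finitely many states the value on `σ σ σ …` is at least `c`. Take `c'` to be `c - 1 / (k + 1)` and
`δ` to be `2⁻¹ ^ k`, with resulting constants `K k`, and concatenate constant blocks whose end
points `t k` grow so fast that `t k` and `K (k + 1)` are negligible compared with `t (k + 1)`. By
Borel–Cantelli almost every run falls short by more than `K k` only on finitely many blocks, hence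
has limit average at least `c`. If the blocks alternate between `a` and `b`, both letters have
frequency `0`.
-/

open Preorder Asymptotics
open scoped ENNReal Topology

/-- The sequence `v` with its first `N` terms removed. -/
def seqShift {α : Type*} (N : ℕ) (v : ℕ → α) : ℕ → α := fun i => v (N + i)

section SequenceMeasures

variable {Q : Type*} [MeasurableSpace Q]

theorem measurable_seqShift (N : ℕ) : Measurable (seqShift (α := Q) N) :=
  measurable_pi_lambda _ fun i => measurable_pi_apply (N + i)

theorem preimage_frestrictLe_singleton {α : Type*} (m : ℕ) (p : ℕ → α) :
    frestrictLe (π := fun _ => α) m ⁻¹' {frestrictLe m p} = {r | ∀ i ≤ m, r i = p i} := by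
  ext r
  simp [funext_iff]

theorem frestrictLe_surjective {α : Type*} (m : ℕ) :
    Function.Surjective (frestrictLe (π := fun _ : ℕ => α) m) := fun x =>
  ⟨fun i => x ⟨min i m, by simp⟩, by
    ext i
    exact congrArg x (Subtype.ext (min_eq_left (mem_Iic.1 i.2)))⟩

theorem preimage_image_frestrictLe_of_dependsOn {α : Type*} {m : ℕ} {E : Set (ℕ → α)}
    (hE : DependsOn (· ∈ E) (Set.Iic m)) : frestrictLe m ⁻¹' (frestrictLe m '' E) = E := by
  refine (Set.subset_preimage_image _ _).antisymm' ?_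
  rintro r ⟨p, hp, hpr⟩
  exact (hE fun i hi => congrFun hpr ⟨i, mem_Iic.2 hi⟩).mp hp

variable [DiscreteMeasurableSpace Q] [Countable Q] {μ ν : Measure (ℕ → Q)}

theorem measurableSet_of_dependsOn {m : ℕ} {E : Set (ℕ → Q)}
    (hE : DependsOn (· ∈ E) (Set.Iic m)) : MeasurableSet E := by
  rw [← preimage_image_frestrictLe_of_dependsOn hE]
  exact measurable_frestrictLe m .of_discrete

theorem map_frestrictLe_eq_of_cylinder {m : ℕ}
    (h : ∀ p : ℕ → Q, μ {r | ∀ i ≤ m, r i = p i} = ν {r | ∀ i ≤ m, r i = p i}) :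
    μ.map (frestrictLe m) = ν.map (frestrictLe m) := by
  refine Measure.ext_of_singleton fun x => ?_
  obtain ⟨p, rfl⟩ := frestrictLe_surjective m x
  rw [Measure.map_apply (by fun_prop) (measurableSet_singleton _),
    Measure.map_apply (by fun_prop) (measurableSet_singleton _),
    preimage_frestrictLe_singleton, h p]

theorem measure_eq_of_cylinder [IsFiniteMeasure ν]
    (h : ∀ (m : ℕ) (p : ℕ → Q), μ {r | ∀ i ≤ m, r i = p i} = ν {r | ∀ i ≤ m, r i = p i}) :
    μ = ν := by
  have marginal (I : Finset ℕ) : μ.map I.restrict = ν.map I.restrict := by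
    have hI : I ⊆ Iic (I.sup id) := I.subset_Iic_sup_id
    rw [← restrict₂_comp_restrict hI, ← Measure.map_map (by fun_prop) (by fun_prop),
      ← Measure.map_map (by fun_prop) (by fun_prop)]
    exact congrArg _ (map_frestrictLe_eq_of_cylinder (h _))
  exact IsProjectiveLimit.unique (P := fun I => ν.map I.restrict) marginal fun _ => rfl

theorem ae_measure_cylinder_ne_zero :
    ∀ᵐ r ∂μ, ∀ m, μ {r' | ∀ i ≤ m, r' i = r i} ≠ 0 := by
  refine ae_all_iff.2 fun m => ?_
  have hne : ∀ᵐ x ∂μ.map (frestrictLe m), μ.map (frestrictLe m) {x} ≠ 0 :=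
    ae_iff_of_countable.2 fun _ => id
  filter_upwards [ae_of_ae_map (by fun_prop) hne] with r hr
  rwa [Measure.map_apply (by fun_prop) (measurableSet_singleton _),
    preimage_frestrictLe_singleton] at hr

end SequenceMeasures

namespace ProbWeightedAutomaton

section RunMeasure

variable {S : Type} (A : ProbWeightedAutomaton S)

instance instIsProbabilityMeasureRunMeasure (w : InfWord S) :
    IsProbabilityMeasure (A.runMeasure w) := by
  unfold runMeasure
  infer_instance

theorem ae_mem_runs (w : InfWord S) : ∀ᵐ r ∂A.runMeasure w, r ∈ A.runs w := by
  filter_upwards [ae_measure_cylinder_ne_zero (μ := A.runMeasure w)] with r hr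
  simp only [runMeasure_cylinder, ne_eq, mul_eq_zero, not_or, prod_eq_zero_iff, not_exists,
    not_and, Finset.mem_range] at hr
  exact ⟨pos_iff_ne_zero.2 (hr 0).1, fun i => pos_iff_ne_zero.2 ((hr (i + 1)).2 i i.lt_succ_self)⟩

theorem map_frestrictLe_runMeasure_congr {w w' : InfWord S} {m : ℕ} (hw : ∀ i < m, w i = w' i) :
    (A.runMeasure w).map (frestrictLe m) = (A.runMeasure w').map (frestrictLe m) := by
  refine map_frestrictLe_eq_of_cylinder fun p => ?_
  rw [runMeasure_cylinder, runMeasure_cylinder]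
  exact congrArg _ (prod_congr rfl fun i hi => by rw [hw i (mem_range.1 hi)])

theorem runMeasure_congr {w w' : InfWord S} {m : ℕ} (hw : ∀ i < m, w i = w' i)
    {E : Set (ℕ → A.State)} (hE : DependsOn (· ∈ E) (Set.Iic m)) :
    A.runMeasure w E = A.runMeasure w' E := by
  rw [← preimage_image_frestrictLe_of_dependsOn hE, ← Measure.map_apply (by fun_prop) .of_discrete,
    ← Measure.map_apply (by fun_prop) .of_discrete, A.map_frestrictLe_runMeasure_congr hw]

/-- The law of the state of `A` after reading the first `N` letters of `w`. -/
noncomputable def stateLaw (w : InfWord S) (N : ℕ) : Measure A.State :=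
  (A.runMeasure w).map fun r => r N

instance instIsProbabilityMeasureStateLaw (w : InfWord S) (N : ℕ) :
    IsProbabilityMeasure (A.stateLaw w N) :=
  Measure.isProbabilityMeasure_map (measurable_pi_apply N).aemeasurable

theorem stateLaw_singleton (w : InfWord S) (N : ℕ) (q : A.State) :
    A.stateLaw w N {q} = A.runMeasure w {r | r N = q} :=
  Measure.map_apply (measurable_pi_apply N) (measurableSet_singleton q)

theorem stateLaw_congr {w w' : InfWord S} {N : ℕ} (hw : ∀ i < N, w i = w' i) :
    A.stateLaw w N = A.stateLaw w' N := by
  refine Measure.ext_of_singleton fun q => ?_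
  rw [stateLaw_singleton, stateLaw_singleton]
  exact A.runMeasure_congr hw fun r p h => by simp [h N (Set.mem_Iic.2 le_rfl)]

/-- The automaton `A` started in the state `q`. Reducible, so that its states are those of `A`
also for instance resolution. -/
noncomputable abbrev startAt (q : A.State) : ProbWeightedAutomaton S :=
  { A with init := PMF.pure q, finiteState := A.finiteState }

theorem runMeasure_inter_succ (w : InfWord S) (n : ℕ) (q q' : A.State) {E : Set (ℕ → A.State)}
    (hE : DependsOn (· ∈ E) (Set.Iic n)) (hq : ∀ r ∈ E, r n = q) :
    A.runMeasure w (E ∩ {r | r (n + 1) = q'}) = A.runMeasure w E * A.step q (w n) q' := by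
  set B : Set (Π _ : Iic n, A.State) := frestrictLe n '' E
  have hB : frestrictLe n ⁻¹' B = E := preimage_image_frestrictLe_of_dependsOn hE
  have hstep : ∀ h ∈ B, A.stepKernel w n h {q'} = A.step q (w n) q' := by
    rintro _ ⟨r, hr, rfl⟩
    change (A.step (r n) (w n)).toMeasure {q'} = _
    rw [hq r hr, PMF.toMeasure_apply_singleton _ _ (measurableSet_singleton _)]
  calc A.runMeasure w (E ∩ {r | r (n + 1) = q'})
      = (A.runMeasure w).map (fun r => (frestrictLe n r, r (n + 1))) (B ×ˢ {q'}) := by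
        rw [Measure.map_apply (by fun_prop) .of_discrete, Set.mk_preimage_prod, hB]
        rfl
    _ = ∫⁻ h in B, A.stepKernel w n h {q'} ∂(A.runMeasure w).map (frestrictLe n) := by
        rw [runMeasure, ← Kernel.map_frestrictLe_trajMeasure_compProd_eq_map_trajMeasure,
          Measure.compProd_apply_prod .of_discrete (measurableSet_singleton _)]
    _ = A.runMeasure w E * A.step q (w n) q' := by
        rw [setLIntegral_congr_fun .of_discrete hstep, setLIntegral_const,
          Measure.map_apply (by fun_prop) .of_discrete, hB, mul_comm]

theorem runMeasure_preimage_seqShift_cylinder (w : InfWord S) (N m : ℕ) (p : ℕ → A.State) :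
    A.runMeasure w (seqShift N ⁻¹' {r | ∀ i ≤ m, r i = p i}) =
      A.stateLaw w N {p 0} * ∏ i ∈ range m, A.step (p i) (w (N + i)) (p (i + 1)) := by
  induction m with
  | zero => simp [stateLaw_singleton, seqShift, Set.preimage]
  | succ m ih =>
    set E : Set (ℕ → A.State) := seqShift N ⁻¹' {r | ∀ i ≤ m, r i = p i}
    have hE : DependsOn (· ∈ E) (Set.Iic (N + m)) := fun r r' h => by
      refine propext (forall₂_congr fun i hi => ?_)
      rw [seqShift, seqShift, h (N + i) (Set.mem_Iic.2 (by lia))]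
    have hsucc : seqShift N ⁻¹' {r | ∀ i ≤ m + 1, r i = p i} =
        E ∩ {r | r (N + m + 1) = p (m + 1)} := by
      ext r
      simp [E, seqShift, Nat.le_succ_iff, or_imp, forall_and, add_assoc]
    rw [hsucc, A.runMeasure_inter_succ w (N + m) (p m) _ hE fun r hr => hr m le_rfl, ih,
      prod_range_succ, mul_assoc]

/-- The law of the state sequence of `A` started in the state `q` and reading `w`. -/
noncomputable def runMeasureFrom (q : A.State) (w : InfWord S) : Measure (ℕ → A.State) :=
  (A.startAt q).runMeasure w

/-- The Markov property. -/
theorem map_seqShift_runMeasure (w : InfWord S) (N : ℕ) :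
    (A.runMeasure w).map (seqShift N) =
      (A.stateLaw w N).bind fun q => A.runMeasureFrom q (seqShift N w) := by
  classical
  have hmeas : Measurable fun q => A.runMeasureFrom q (seqShift N w) := .of_discrete
  have : IsProbabilityMeasure ((A.runMeasure w).map (seqShift N)) :=
    Measure.isProbabilityMeasure_map (measurable_seqShift N).aemeasurable
  refine Eq.symm (measure_eq_of_cylinder fun m p => ?_)
  have hcyl : MeasurableSet {r : ℕ → A.State | ∀ i ≤ m, r i = p i} := by
    rw [← preimage_frestrictLe_singleton]
    exact (measurable_frestrictLe m) (measurableSet_singleton _)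
  calc (A.stateLaw w N).bind _ {r : ℕ → A.State | ∀ i ≤ m, r i = p i}
      = ∫⁻ q, ({p 0} : Set A.State).indicator 1 q *
          ∏ i ∈ range m, A.step (p i) (w (N + i)) (p (i + 1)) ∂A.stateLaw w N := by
        rw [Measure.bind_apply hcyl hmeas.aemeasurable]
        refine lintegral_congr fun q => ((A.startAt q).runMeasure_cylinder _ p m).trans ?_
        simp [seqShift, PMF.pure_apply, Set.indicator_apply, eq_comm (a := q)]
    _ = A.stateLaw w N {p 0} * ∏ i ∈ range m, A.step (p i) (w (N + i)) (p (i + 1)) := by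
        rw [lintegral_mul_const _ .of_discrete, lintegral_indicator_one (measurableSet_singleton _)]
    _ = _ := by
        rw [Measure.map_apply (measurable_seqShift N) hcyl, runMeasure_preimage_seqShift_cylinder]

end RunMeasure

end ProbWeightedAutomaton

section LimAvg

variable {v : ℕ → ℚ} {β : ℝ}

theorem abs_sum_range_le (hv : ∀ i, |(v i : ℝ)| ≤ β) (n : ℕ) :
    |∑ i ∈ range n, (v i : ℝ)| ≤ β * n :=
  calc |∑ i ∈ range n, (v i : ℝ)| ≤ ∑ i ∈ range n, |(v i : ℝ)| := abs_sum_le_sum_abs _ _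
    _ ≤ ∑ _i ∈ range n, β := sum_le_sum fun i _ => hv i
    _ = β * n := by simp [mul_comm]

theorem abs_average_le (hv : ∀ i, |(v i : ℝ)| ≤ β) (n : ℕ) :
    |(1 / (n : ℝ)) * ∑ i ∈ range n, (v i : ℝ)| ≤ β := by
  rcases n.eq_zero_or_pos with rfl | hn
  · simpa using (abs_nonneg _).trans (hv 0)
  · rw [abs_mul, abs_of_nonneg (by positivity), one_div, inv_mul_le_iff₀ (by positivity), mul_comm]
    exact abs_sum_range_le hv n

theorem isBoundedUnder_le_average (hv : ∀ i, |(v i : ℝ)| ≤ β) :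
    IsBoundedUnder (· ≤ ·) atTop fun n : ℕ => (1 / (n : ℝ)) * ∑ i ∈ range n, (v i : ℝ) :=
  isBoundedUnder_of ⟨β, fun n => (abs_le.1 (abs_average_le hv n)).2⟩

theorem isBoundedUnder_ge_average (hv : ∀ i, |(v i : ℝ)| ≤ β) :
    IsBoundedUnder (· ≥ ·) atTop fun n : ℕ => (1 / (n : ℝ)) * ∑ i ∈ range n, (v i : ℝ) :=
  isBoundedUnder_of ⟨-β, fun n => (abs_le.1 (abs_average_le hv n)).1⟩

theorem limAvg_le_of_frequently_le (hv : ∀ i, |(v i : ℝ)| ≤ β) {c : ℝ}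
    (h : ∃ᶠ n : ℕ in atTop, ∑ i ∈ range n, (v i : ℝ) ≤ c * n) : limAvg v ≤ c := by
  refine liminf_le_of_frequently_le ?_ (isBoundedUnder_ge_average hv)
  refine (h.and_eventually (eventually_gt_atTop 0)).mono fun n ⟨hn, hn0⟩ => ?_
  rwa [one_div, inv_mul_le_iff₀ (by positivity), mul_comm]

theorem le_limAvg_of_eventually_le (hv : ∀ i, |(v i : ℝ)| ≤ β) {c : ℝ}
    (h : ∀ᶠ n : ℕ in atTop, c * n ≤ ∑ i ∈ range n, (v i : ℝ)) : c ≤ limAvg v := by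
  refine le_liminf_of_le (isBoundedUnder_le_average hv).isCoboundedUnder_ge ?_
  filter_upwards [h, eventually_gt_atTop 0] with n hn hn0
  rwa [one_div, le_inv_mul_iff₀ (by positivity), mul_comm]

theorem eventually_le_sum_of_lt_limAvg (hv : ∀ i, |(v i : ℝ)| ≤ β) {c : ℝ} (h : c < limAvg v) :
    ∀ᶠ n : ℕ in atTop, c * n ≤ ∑ i ∈ range n, (v i : ℝ) := by
  filter_upwards [eventually_lt_of_lt_liminf h (isBoundedUnder_ge_average hv),
    eventually_gt_atTop 0] with n hn hn0
  rw [one_div, lt_inv_mul_iff₀ (by positivity), mul_comm] at hn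
  exact hn.le

theorem abs_limAvg_le (hv : ∀ i, |(v i : ℝ)| ≤ β) : |limAvg v| ≤ β :=
  abs_le.2 ⟨le_limAvg_of_eventually_le hv
      (.of_forall fun n => neg_mul β (n : ℝ) ▸ (abs_le.1 (abs_sum_range_le hv n)).1),
    limAvg_le_of_frequently_le hv
      (.of_forall fun n => (abs_le.1 (abs_sum_range_le hv n)).2)⟩

theorem limAvg_eq_of_eventually_eq {c : ℚ} (h : ∀ᶠ i in atTop, v i = c) : limAvg v = c := by
  have hlim : Tendsto (fun i => (v i : ℝ)) atTop (𝓝 (c : ℝ)) :=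
    tendsto_const_nhds.congr' (h.mono fun i hi => congrArg _ hi.symm)
  simpa only [limAvg, one_div] using hlim.cesaro.liminf_eq

/-- Up to time `m`, the partial sums of `v` fall short of the average `c` by at most `K`. -/
def DeficitLE (c K : ℝ) (m : ℕ) (v : ℕ → ℚ) : Prop :=
  ∀ n ≤ m, c * n ≤ ∑ i ∈ range n, (v i : ℝ) + K

theorem DeficitLE.mono {c c' K K' : ℝ} {m m' : ℕ} (h : DeficitLE c K m v) (hc : c' ≤ c)
    (hK : K ≤ K') (hm : m' ≤ m) : DeficitLE c' K' m' v := fun n hn =>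
  calc c' * n ≤ c * n := by gcongr
    _ ≤ ∑ i ∈ range n, (v i : ℝ) + K := h n (hn.trans hm)
    _ ≤ ∑ i ∈ range n, (v i : ℝ) + K' := by gcongr

theorem deficitLE_congr {c K : ℝ} {m : ℕ} {v v' : ℕ → ℚ} (h : ∀ i < m, v i = v' i) :
    DeficitLE c K m v ↔ DeficitLE c K m v' :=
  forall₂_congr fun n hn => by
    rw [sum_congr rfl fun i hi => by rw [h i ((mem_range.1 hi).trans_le hn)]]

theorem sum_range_add_sum_range_seqShift {s n : ℕ} (h : s ≤ n) :
    ∑ i ∈ range s, (v i : ℝ) + ∑ i ∈ range (n - s), ((seqShift s v i : ℚ) : ℝ) =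
      ∑ i ∈ range n, (v i : ℝ) := by
  rw [← Nat.add_sub_cancel' h, sum_range_add, Nat.add_sub_cancel_left]
  rfl

theorem DeficitLE.sum_range_le {c K : ℝ} {s t n : ℕ} (h : DeficitLE c K (t - s) (seqShift s v))
    (hs : s ≤ n) (ht : n ≤ t) :
    ∑ i ∈ range s, (v i : ℝ) + c * (n - s) ≤ ∑ i ∈ range n, (v i : ℝ) + K := by
  have := h (n - s) (Nat.sub_le_sub_right ht s)
  rw [Nat.cast_sub hs] at this
  rw [← sum_range_add_sum_range_seqShift hs]
  linarith

theorem exists_deficitLE_of_lt_limAvg (hv : ∀ i, |(v i : ℝ)| ≤ β) {c : ℝ} (h : c < limAvg v) :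
    ∃ K : ℕ, ∀ m, DeficitLE c K m v := by
  have hbdd : IsBoundedUnder (· ≤ ·) atTop fun n : ℕ => c * n - ∑ i ∈ range n, (v i : ℝ) :=
    isBoundedUnder_of_eventually_le (a := 0)
      ((eventually_le_sum_of_lt_limAvg hv h).mono fun n => sub_nonpos.2)
  obtain ⟨B, hB⟩ := hbdd.bddAbove_range
  obtain ⟨K, hK⟩ := exists_nat_ge B
  exact ⟨K, fun m n _ => by linarith [hB (Set.mem_range_self n)]⟩

theorem limAvg_le_limAvg_seqShift (hv : ∀ i, |(v i : ℝ)| ≤ β) (N : ℕ) :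
    limAvg v ≤ limAvg (seqShift N v) := by
  refine le_of_forall_lt_imp_le_of_dense fun c hc => ?_
  obtain ⟨c', hcc', hc'⟩ := exists_between hc
  refine le_limAvg_of_eventually_le (v := seqShift N v) (fun i => hv (N + i)) ?_
  have hlarge : ∀ᶠ n : ℕ in atTop, ∑ i ∈ range N, (v i : ℝ) - c' * N ≤ (c' - c) * n :=
    (tendsto_natCast_atTop_atTop.const_mul_atTop (sub_pos.2 hcc')).eventually_ge_atTop _
  filter_upwards [hlarge,
    (tendsto_add_atTop_nat N).eventually (eventually_le_sum_of_lt_limAvg hv hc')] with n hn hsum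
  rw [← sum_range_add_sum_range_seqShift (N.le_add_left n), Nat.add_sub_cancel] at hsum
  push_cast at hsum
  linarith

end LimAvg

section Blocks

/-- The index `k` of the block `[t k, t (k + 1))` that contains `n`, for a strictly increasing `t`
and `t 0 ≤ n`. -/
def blockIndex (t : ℕ → ℕ) (n : ℕ) : ℕ := Nat.findGreatest (t · ≤ n) n

/-- The word that reads the letter `s k` on the block `[t k, t (k + 1))`. -/
def blockWord {S : Type} (t : ℕ → ℕ) (s : ℕ → S) : InfWord S := fun n => s (blockIndex t n)

variable {t : ℕ → ℕ}

theorem apply_blockIndex_le {n : ℕ} (h : t 0 ≤ n) : t (blockIndex t n) ≤ n :=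
  Nat.findGreatest_spec (P := (t · ≤ n)) n.zero_le h

theorem le_blockIndex (ht : StrictMono t) {k n : ℕ} (h : t k ≤ n) : k ≤ blockIndex t n :=
  Nat.le_findGreatest (ht.le_apply.trans h) h

theorem lt_apply_blockIndex_succ (ht : StrictMono t) (n : ℕ) : n < t (blockIndex t n + 1) :=
  lt_of_not_ge fun h => (le_blockIndex ht h).not_gt (Nat.lt_succ_self _)

theorem tendsto_blockIndex (ht : StrictMono t) : Tendsto (blockIndex t) atTop atTop :=
  tendsto_atTop.2 fun k => (eventually_ge_atTop (t k)).mono fun _ => le_blockIndex ht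

theorem blockWord_apply {S : Type} (ht : StrictMono t) (s : ℕ → S) {k n : ℕ} (hk : t k ≤ n)
    (hn : n < t (k + 1)) : blockWord t s n = s k := by
  have hle : t (blockIndex t n) ≤ n := apply_blockIndex_le ((ht.monotone k.zero_le).trans hk)
  rw [blockWord, (Nat.lt_succ_iff.1 (ht.lt_iff_lt.1 (hle.trans_lt hn))).antisymm
    (le_blockIndex ht hk)]

theorem eventually_of_eventually_blocks (ht : StrictMono t) {P : ℕ → Prop}
    (h : ∀ᶠ k in atTop, ∀ n, t k ≤ n → n < t (k + 1) → P n) : ∀ᶠ n in atTop, P n := by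
  filter_upwards [(tendsto_blockIndex ht).eventually h, eventually_ge_atTop (t 0)] with n hn hn0
  exact hn n (apply_blockIndex_le hn0) (lt_apply_blockIndex_succ ht n)

theorem isLittleO_of_natCast_mul_le {f g : ℕ → ℝ} (h : ∀ k : ℕ, k * |f k| ≤ |g k|) :
    f =o[atTop] g := by
  refine isLittleO_iff_nat_mul_le.2 fun n => ?_
  filter_upwards [eventually_ge_atTop n] with k hk
  exact le_trans (by gcongr; rfl) (h k)

theorem exists_strictMono_isLittleO (K : ℕ → ℝ) :
    ∃ t : ℕ → ℕ, StrictMono t ∧ (fun k => (t k : ℝ)) =o[atTop] (fun k => (t (k + 1) : ℝ)) ∧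
      K =o[atTop] fun k => (t k : ℝ) := by
  let t : ℕ → ℕ := fun k => k.rec 0 fun k tk => (k + 1) * (tk + ⌈|K (k + 1)|⌉₊ + 1)
  have ht (k : ℕ) : t (k + 1) = (k + 1) * (t k + ⌈|K (k + 1)|⌉₊ + 1) := rfl
  refine ⟨t, strictMono_nat_of_lt_succ fun k => ?_, isLittleO_of_natCast_mul_le fun k => ?_,
    isLittleO_of_natCast_mul_le fun k => ?_⟩
  · rw [ht]
    nlinarith [(k * (t k + ⌈|K (k + 1)|⌉₊ + 1)).zero_le]
  · rw [Nat.abs_cast, Nat.abs_cast, ht]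
    push_cast
    gcongr <;> linarith [Nat.cast_nonneg (α := ℝ) ⌈|K (k + 1)|⌉₊]
  · cases k with
    | zero => simp
    | succ k =>
      rw [Nat.abs_cast, ht]
      push_cast
      gcongr
      linarith [Nat.le_ceil |K (k + 1)|, Nat.cast_nonneg (α := ℝ) (t k)]

theorem le_limAvg_of_blocks {v : ℕ → ℚ} {β : ℝ} (hv : ∀ i, |(v i : ℝ)| ≤ β) (ht : StrictMono t)
    (hto : (fun k => (t k : ℝ)) =o[atTop] fun k => (t (k + 1) : ℝ)) {K : ℕ → ℝ}
    (hK : K =o[atTop] fun k => (t k : ℝ)) {c : ℕ → ℝ} {a : ℝ} (hc : Tendsto c atTop (𝓝 a))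
    (h : ∀ᶠ k in atTop, DeficitLE (c k) (K k) (t (k + 1) - t k) (seqShift (t k) v)) :
    a ≤ limAvg v := by
  refine le_of_forall_lt_imp_le_of_dense fun a₀ ha₀ => ?_
  obtain ⟨a₁, ha₀₁, ha₁⟩ := exists_between ha₀
  have hblock : ∀ᶠ k in atTop, DeficitLE a₁ (K k) (t (k + 1) - t k) (seqShift (t k) v) := by
    filter_upwards [h, hc.eventually (eventually_ge_nhds ha₁)] with k hk hck
    exact hk.mono hck le_rfl le_rfl
  -- Compared with `a₁ * n`, a sum inside block `k + 1` loses at most `(β + a₁) * t k` before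
  -- block `k` and then the two deficits `K k` and `K (k + 1)`.
  have herror : (fun k => (β + a₁) * t k + K k + K (k + 1)) =o[atTop]
      fun k => (t (k + 1) : ℝ) :=
    ((hto.const_mul_left _).add (hK.trans hto)).add (hK.comp_tendsto (tendsto_add_atTop_nat 1))
  refine le_limAvg_of_eventually_le hv (eventually_of_eventually_blocks ht ?_)
  rw [← map_add_atTop_eq_nat 1, eventually_map]
  filter_upwards [hblock, (tendsto_add_atTop_nat 1).eventually hblock,
    herror.bound (sub_pos.2 ha₀₁)] with k hk hk' hek n hkn hnk
  have hlast := hk'.sum_range_le hkn hnk.le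
  have hprev := hk.sum_range_le (ht.monotone k.le_succ) le_rfl
  have hfirst := (abs_le.1 (abs_sum_range_le hv (t k))).1
  have hek' := (le_abs_self _).trans hek
  rw [Real.norm_natCast] at hek'
  have hn : (a₁ - a₀) * (t (k + 1) : ℝ) ≤ (a₁ - a₀) * n := by
    have := sub_pos.2 ha₀₁
    gcongr
  linarith

theorem abs_indicator_letter_le_one (σ : Letter) (w : InfWord Letter) (i : ℕ) :
    |((if w i = σ then 1 else 0 : ℚ) : ℝ)| ≤ 1 := by
  split_ifs <;> simp

theorem freqLang_nonneg (σ : Letter) (w : InfWord Letter) : 0 ≤ freqLang σ w := by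
  refine le_limAvg_of_eventually_le (abs_indicator_letter_le_one σ w) (.of_forall fun n => ?_)
  rw [zero_mul]
  exact sum_nonneg fun i _ => by split_ifs <;> simp

theorem freqLang_blockWord_eq_zero (ht : StrictMono t)
    (hto : (fun k => (t k : ℝ)) =o[atTop] fun k => (t (k + 1) : ℝ)) {s : ℕ → Letter}
    {σ : Letter} (hs : ∃ᶠ k in atTop, s k ≠ σ) : freqLang σ (blockWord t s) = 0 := by
  have hbound := abs_indicator_letter_le_one σ (blockWord t s)
  refine le_antisymm (le_of_forall_pos_le_add fun ε hε => ?_) (freqLang_nonneg _ _)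
  rw [zero_add]
  refine limAvg_le_of_frequently_le hbound ?_
  refine (ht.tendsto_atTop.comp (tendsto_add_atTop_nat 1)).frequently ?_
  refine (hs.and_eventually (hto.bound hε)).mono fun k ⟨hk, hkε⟩ => ?_
  rw [Real.norm_natCast, Real.norm_natCast] at hkε
  have hle : t k ≤ t (k + 1) := ht.monotone k.le_succ
  have hblock : ∑ i ∈ range (t (k + 1) - t k),
      ((seqShift (t k) (fun i => if blockWord t s i = σ then (1 : ℚ) else 0) i : ℚ) : ℝ) = 0 :=
    sum_eq_zero fun i hi => by
      have hi := mem_range.1 hi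
      rw [seqShift, blockWord_apply ht s ((t k).le_add_right i) (by lia), if_neg hk, Rat.cast_zero]
  rw [Function.comp_apply, ← sum_range_add_sum_range_seqShift hle, hblock, add_zero]
  exact ((le_abs_self _).trans (abs_sum_range_le hbound (t k))).trans ((one_mul _).trans_le hkε)

end Blocks

namespace ProbWeightedAutomaton

section AsLimAvg

variable {S : Type} (A : ProbWeightedAutomaton S)

theorem exists_abs_weight_le [Finite S] : ∃ β : ℝ, ∀ q σ q', |(A.weight q σ q' : ℝ)| ≤ β := by
  obtain ⟨β, hβ⟩ := (Set.finite_range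
    fun x : A.State × S × A.State => |(A.weight x.1 x.2.1 x.2.2 : ℝ)|).bddAbove
  exact ⟨β, fun q σ q' => hβ ⟨(q, σ, q'), rfl⟩⟩

theorem measurable_limAvg_weights (w : InfWord S) :
    Measurable fun r => limAvg (A.weights w r) := by
  refine Measurable.liminf fun n => measurable_const.mul (Finset.measurable_sum _ fun i _ => ?_)
  have hweight : Measurable fun x : A.State × A.State => (A.weight x.1 (w i) x.2 : ℝ) :=
    .of_discrete
  have hpair : Measurable fun r : ℕ → A.State => (r i, r (i + 1)) :=
    (measurable_pi_apply i).prodMk (measurable_pi_apply (i + 1))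
  exact hweight.comp hpair

theorem asLimAvg_eq_essInf (w : InfWord S) :
    A.asLimAvg w = essInf (fun r => limAvg (A.weights w r)) (A.runMeasure w) := by
  rw [essInf_eq_sSup, asLimAvg]
  congr 1
  ext η
  have hruns : {r | r ∈ A.runs w ∧ η ≤ limAvg (A.weights w r)} =ᵐ[A.runMeasure w]
      {r | η ≤ limAvg (A.weights w r)} :=
    (A.ae_mem_runs w).mono fun r hr => propext (and_iff_right hr)
  rw [Set.mem_ofPred_eq, Set.mem_ofPred_eq, measure_congr hruns, ← mem_ae_iff_prob_eq_one
    (measurableSet_le measurable_const (A.measurable_limAvg_weights w)), mem_ae_iff]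
  simp only [Set.compl_ofPred, not_le]

theorem le_asLimAvg_iff [Finite S] {w : InfWord S} {c : ℝ} :
    c ≤ A.asLimAvg w ↔ ∀ᵐ r ∂A.runMeasure w, c ≤ limAvg (A.weights w r) := by
  obtain ⟨β, hβ⟩ := A.exists_abs_weight_le
  have habs (r : ℕ → A.State) := abs_le.1 (abs_limAvg_le (v := A.weights w r) fun i => hβ _ _ _)
  have hbelow : IsBoundedUnder (· ≥ ·) (ae (A.runMeasure w)) fun r => limAvg (A.weights w r) :=
    isBoundedUnder_of ⟨-β, fun r => (habs r).1⟩
  have habove : IsBoundedUnder (· ≤ ·) (ae (A.runMeasure w)) fun r => limAvg (A.weights w r) :=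
    isBoundedUnder_of ⟨β, fun r => (habs r).2⟩
  rw [asLimAvg_eq_essInf]
  exact ⟨fun h => (ae_essInf_le hbelow).mono fun r => h.trans,
    fun h => le_essInf_of_ae_le c h habove.isCoboundedUnder_ge⟩

theorem ae_asLimAvg_le_startAt [Finite S] (w : InfWord S) (N : ℕ) :
    ∀ᵐ q ∂A.stateLaw w N, A.asLimAvg w ≤ (A.startAt q).asLimAvg (seqShift N w) := by
  obtain ⟨β, hβ⟩ := A.exists_abs_weight_le
  have hshift : ∀ᵐ r ∂(A.runMeasure w).map (seqShift N),
      A.asLimAvg w ≤ limAvg (A.weights (seqShift N w) r) := by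
    rw [ae_map_iff (measurable_seqShift N).aemeasurable
      (measurableSet_le measurable_const (A.measurable_limAvg_weights _))]
    filter_upwards [A.le_asLimAvg_iff.1 le_rfl] with r hr
    exact hr.trans (limAvg_le_limAvg_seqShift (fun i => hβ _ _ _) N)
  rw [map_seqShift_runMeasure] at hshift
  filter_upwards [Measure.ae_ae_of_ae_bind Measurable.of_discrete.aemeasurable hshift] with q hq
  exact (A.startAt q).le_asLimAvg_iff.2 hq

end AsLimAvg

section Deterministic

variable {S : Type} {A : ProbWeightedAutomaton S}

theorem IsDeterministic.subsingleton_runs (hA : A.IsDeterministic) (w : InfWord S) :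
    (A.runs w).Subsingleton := by
  have point_mass {p : PMF A.State} (hp : ∃ q, p q = 1) {q q' : A.State} (hq : 0 < p q)
      (hq' : 0 < p q') : q = q' := by
    obtain ⟨q₀, hq₀⟩ := hp
    have hsupp := (PMF.apply_eq_one_iff p q₀).1 hq₀
    have heq {x : A.State} (hx : 0 < p x) : x = q₀ := by
      simpa [hsupp] using (PMF.apply_pos_iff p x).1 hx
    rw [heq hq, heq hq']
  intro r hr r' hr'
  funext n
  induction n with
  | zero => exact point_mass hA.1 hr.1 hr'.1
  | succ n ih => exact point_mass (hA.2 (r n) (w n)) (hr.2 n) (ih ▸ hr'.2 n)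

theorem IsDeterministic.asLimAvg_eq_maxLimAvg (hA : A.IsDeterministic) :
    A.asLimAvg = A.maxLimAvg := by
  funext w
  obtain ⟨r₀, hr₀⟩ := (A.ae_mem_runs w).exists
  have hruns : A.runs w = {r₀} := (hA.subsingleton_runs w).eq_singleton_of_mem hr₀
  have hconst : (fun r => limAvg (A.weights w r)) =ᵐ[A.runMeasure w]
      fun _ => limAvg (A.weights w r₀) := by
    filter_upwards [A.ae_mem_runs w] with r hr
    rw [hA.subsingleton_runs w hr hr₀]
  rw [asLimAvg_eq_essInf, essInf_congr_ae hconst, essInf_const', maxLimAvg]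
  simp [hruns, Set.ofPred_eq_eq_singleton]

end Deterministic

end ProbWeightedAutomaton

section FreqLang

open ProbWeightedAutomaton

theorem IsDLimAvg.isAsLimAvg {S : Type} {L : QuantLang S} (hL : IsDLimAvg L) : IsAsLimAvg L := by
  obtain ⟨A, hA, rfl⟩ := hL
  exact ⟨A, hA.asLimAvg_eq_maxLimAvg⟩

/-- The one-state automaton whose weights count the letter `σ`; it defines `freqLang σ`. -/
noncomputable def freqAutomaton (σ : Letter) : ProbWeightedAutomaton Letter where
  State := Unit
  init := PMF.pure ()
  step _ _ := PMF.pure ()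
  weight _ τ _ := if τ = σ then 1 else 0

theorem isDeterministic_freqAutomaton (σ : Letter) : (freqAutomaton σ).IsDeterministic :=
  ⟨⟨(), PMF.pure_apply_self _⟩, fun _ _ => ⟨(), PMF.pure_apply_self _⟩⟩

theorem maxLimAvg_freqAutomaton (σ : Letter) : (freqAutomaton σ).maxLimAvg = freqLang σ := by
  funext w
  obtain ⟨r, hr⟩ := ((freqAutomaton σ).ae_mem_runs w).exists
  have hvalues : {x | ∃ r ∈ (freqAutomaton σ).runs w,
      x = limAvg ((freqAutomaton σ).weights w r)} = {freqLang σ w} :=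
    Set.eq_singleton_iff_unique_mem.2 ⟨⟨r, hr, rfl⟩, fun _ ⟨_, _, hx⟩ => hx⟩
  rw [maxLimAvg, hvalues, csSup_singleton]

theorem isDLimAvg_freqLang (σ : Letter) : IsDLimAvg (freqLang σ) :=
  ⟨freqAutomaton σ, isDeterministic_freqAutomaton σ, maxLimAvg_freqAutomaton σ⟩

theorem freqLang_appendConst (u : List Letter) (σ τ : Letter) :
    freqLang τ (appendConst u σ) = if σ = τ then 1 else 0 := by
  have hconst : ∀ᶠ i in atTop,
      (if appendConst u σ i = τ then (1 : ℚ) else 0) = if σ = τ then 1 else 0 := by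
    filter_upwards [eventually_ge_atTop u.length] with i hi
    rw [appendConst, List.getD_eq_default _ _ hi]
  rw [freqLang, limAvg_eq_of_eventually_eq hconst]
  split_ifs <;> simp

theorem freqLang_add_appendConst (u : List Letter) (σ : Letter) :
    (freqLang Letter.a + freqLang Letter.b) (appendConst u σ) = 1 := by
  cases σ <;> simp [freqLang_appendConst]

end FreqLang

namespace ProbWeightedAutomaton

section UniformDeviation

variable {S : Type} (A : ProbWeightedAutomaton S)

theorem dependsOn_not_deficitLE_weights (w : InfWord S) (c K : ℝ) (m : ℕ) :
    DependsOn (· ∈ {r | ¬ DeficitLE c K m (A.weights w r)}) (Set.Iic m) := fun r p h =>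
  congrArg Not (propext (deficitLE_congr fun i hi => by
    rw [weights, weights, h i (Set.mem_Iic.2 hi.le), h (i + 1) (Set.mem_Iic.2 hi)]))

theorem runMeasure_not_deficitLE_congr {w w' : InfWord S} {m : ℕ} (hw : ∀ i < m, w i = w' i)
    (c K : ℝ) : A.runMeasure w {r | ¬ DeficitLE c K m (A.weights w r)} =
      A.runMeasure w' {r | ¬ DeficitLE c K m (A.weights w' r)} := by
  have hset : {r | ¬ DeficitLE c K m (A.weights w r)} =
      {r | ¬ DeficitLE c K m (A.weights w' r)} :=
    Set.ext fun r => not_congr (deficitLE_congr fun i hi => by rw [weights, weights, hw i hi])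
  rw [hset, A.runMeasure_congr hw (A.dependsOn_not_deficitLE_weights w' c K m)]

theorem measurableSet_not_deficitLE_weights (w : InfWord S) (c K : ℝ) (m : ℕ) :
    MeasurableSet {r | ¬ DeficitLE c K m (A.weights w r)} :=
  measurableSet_of_dependsOn (A.dependsOn_not_deficitLE_weights w c K m)

theorem eventually_runMeasure_not_deficitLE_le [Finite S] {w : InfWord S} {c : ℝ}
    (hc : c < A.asLimAvg w) {δ : ℝ≥0∞} (hδ : δ ≠ 0) :
    ∀ᶠ K : ℕ in atTop, ∀ m, A.runMeasure w {r | ¬ DeficitLE c K m (A.weights w r)} ≤ δ := by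
  obtain ⟨β, hβ⟩ := A.exists_abs_weight_le
  let D : ℕ → Set (ℕ → A.State) := fun K => ⋃ m, {r | ¬ DeficitLE c K m (A.weights w r)}
  have hmeas (K : ℕ) : MeasurableSet (D K) :=
    .iUnion fun m => A.measurableSet_not_deficitLE_weights w c K m
  have hanti : Antitone D := fun K K' hK =>
    Set.iUnion_mono fun m r hr h => hr (h.mono le_rfl (Nat.cast_le.2 hK) le_rfl)
  have hnull : A.runMeasure w (⋂ K, D K) = 0 := by
    rw [measure_eq_zero_iff_ae_notMem]
    filter_upwards [A.le_asLimAvg_iff.1 le_rfl] with r hr hrD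
    obtain ⟨K, hK⟩ := exists_deficitLE_of_lt_limAvg (fun i => hβ _ _ _) (hc.trans_le hr)
    obtain ⟨m, hm⟩ := Set.mem_iUnion.1 (Set.mem_iInter.1 hrD K)
    exact hm (hK m)
  have hlim : Tendsto (fun K => A.runMeasure w (D K)) atTop (𝓝 0) :=
    hnull ▸ tendsto_measure_iInter_atTop (fun K => (hmeas K).nullMeasurableSet) hanti
      ⟨0, measure_ne_top _ _⟩
  filter_upwards [hlim.eventually_lt_const (pos_iff_ne_zero.2 hδ)] with K hK m
  exact (measure_mono (Set.subset_iUnion _ m)).trans hK.le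

variable {A} {c : ℝ}

theorem le_asLimAvg_startAt_of_reachable [Finite S]
    (h : ∀ (u : List S) (σ : S), c ≤ A.asLimAvg (appendConst u σ)) {w : InfWord S} {N : ℕ}
    {q : A.State} (hq : A.stateLaw w N {q} ≠ 0) (σ : S) :
    c ≤ (A.startAt q).asLimAvg fun _ => σ := by
  set v : InfWord S := appendConst (List.ofFn fun i : Fin N => w i) σ
  have hwv (i : ℕ) (hi : i < N) : w i = v i := by simp [v, appendConst, hi]
  have hshift : seqShift N v = fun _ => σ := funext fun i => by simp [v, seqShift, appendConst]
  rw [A.stateLaw_congr hwv] at hq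
  have hle := ae_iff_of_countable.1 (A.ae_asLimAvg_le_startAt v N) q hq
  rw [hshift] at hle
  exact (h _ σ).trans hle

/-- The law of the suffix depends on the prefix only through the current state, of which there are
finitely many; hence the uniformity in `w` and `N`. -/
theorem exists_uniform_runMeasure_not_deficitLE_le [Finite S]
    (h : ∀ (u : List S) (σ : S), c ≤ A.asLimAvg (appendConst u σ)) {c' : ℝ} (hc' : c' < c)
    {δ : ℝ≥0∞} (hδ : δ ≠ 0) :
    ∃ K : ℕ, ∀ (w : InfWord S) (N m : ℕ) (σ : S), (∀ i < m, w (N + i) = σ) →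
      A.runMeasure w {r | ¬ DeficitLE c' K m (seqShift N (A.weights w r))} ≤ δ := by
  have hstate (q : A.State) (σ : S) : ∀ᶠ K : ℕ in atTop,
      (∃ w N, A.stateLaw w N {q} ≠ 0) → ∀ m, A.runMeasureFrom q (fun _ => σ)
        {r | ¬ DeficitLE c' K m (A.weights (fun _ => σ) r)} ≤ δ := by
    by_cases hq : ∃ w N, A.stateLaw w N {q} ≠ 0
    · obtain ⟨w, N, hwN⟩ := hq
      refine (eventually_runMeasure_not_deficitLE_le _ ?_ hδ).mono fun K hK _ => hK
      exact hc'.trans_le (le_asLimAvg_startAt_of_reachable h hwN σ)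
    · exact .of_forall fun K hq' => absurd hq' hq
  obtain ⟨K, hK⟩ := (eventually_all.2 fun q => eventually_all.2 (hstate q)).exists
  refine ⟨K, fun w N m σ hw => ?_⟩
  have hmeas := A.measurableSet_not_deficitLE_weights (seqShift N w) c' K m
  calc A.runMeasure w {r | ¬ DeficitLE c' K m (seqShift N (A.weights w r))}
      = (A.runMeasure w).map (seqShift N)
          {r | ¬ DeficitLE c' K m (A.weights (seqShift N w) r)} :=
        (Measure.map_apply (measurable_seqShift N) hmeas).symm
    _ = ∫⁻ q, A.runMeasureFrom q (seqShift N w)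
          {r | ¬ DeficitLE c' K m (A.weights (seqShift N w) r)} ∂A.stateLaw w N := by
        rw [map_seqShift_runMeasure,
          Measure.bind_apply hmeas Measurable.of_discrete.aemeasurable]
    _ ≤ ∫⁻ _, δ ∂A.stateLaw w N := by
        refine lintegral_mono_ae (ae_iff_of_countable.2 fun q hq => ?_)
        exact ((A.startAt q).runMeasure_not_deficitLE_congr hw c' K).trans_le
          (hK q σ ⟨w, N, hq⟩ m)
    _ = δ := by rw [lintegral_const, measure_univ, mul_one]

theorem exists_blockWord_le_asLimAvg [Finite S]
    (h : ∀ (u : List S) (σ : S), c ≤ A.asLimAvg (appendConst u σ)) (s : ℕ → S) :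
    ∃ t : ℕ → ℕ, StrictMono t ∧ (fun k => (t k : ℝ)) =o[atTop] (fun k => (t (k + 1) : ℝ)) ∧
      c ≤ A.asLimAvg (blockWord t s) := by
  obtain ⟨β, hβ⟩ := A.exists_abs_weight_le
  have hthreshold (k : ℕ) : c - 1 / (k + 1) < c := sub_lt_self c Nat.one_div_pos_of_nat
  have hδ (k : ℕ) : (2⁻¹ : ℝ≥0∞) ^ k ≠ 0 := by simp
  choose K hK using fun k => exists_uniform_runMeasure_not_deficitLE_le h (hthreshold k) (hδ k)
  obtain ⟨t, ht, hto, hKt⟩ := exists_strictMono_isLittleO fun k => (K k : ℝ)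
  refine ⟨t, ht, hto, A.le_asLimAvg_iff.2 ?_⟩
  set w := blockWord t s
  let badRuns : ℕ → Set (ℕ → A.State) := fun k =>
    {r | ¬ DeficitLE (c - 1 / (k + 1)) (K k) (t (k + 1) - t k) (seqShift (t k) (A.weights w r))}
  have hbad (k : ℕ) : A.runMeasure w (badRuns k) ≤ 2⁻¹ ^ k :=
    hK k w (t k) _ (s k) fun i hi => blockWord_apply ht s ((t k).le_add_right i) (by lia)
  have hsummable : ∑' k, A.runMeasure w (badRuns k) ≠ ∞ :=
    ne_top_of_le_ne_top (by simp [ENNReal.tsum_geometric]) (ENNReal.tsum_le_tsum hbad)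
  have hlim : Tendsto (fun k : ℕ => c - 1 / ((k : ℝ) + 1)) atTop (𝓝 c) := by
    simpa using tendsto_one_div_add_atTop_nhds_zero_nat.const_sub c
  filter_upwards [ae_eventually_notMem hsummable] with r hr
  exact le_limAvg_of_blocks (fun i => hβ _ _ _) ht hto hKt hlim (hr.mono fun k => not_not.1)

end UniformDeviation

end ProbWeightedAutomaton

section Sum

open ProbWeightedAutomaton

theorem exists_freqLang_eq_zero_le_asLimAvg {A : ProbWeightedAutomaton Letter} {c : ℝ}
    (h : ∀ (u : List Letter) (σ : Letter), c ≤ A.asLimAvg (appendConst u σ)) :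
    ∃ w : InfWord Letter,
      freqLang Letter.a w = 0 ∧ freqLang Letter.b w = 0 ∧ c ≤ A.asLimAvg w := by
  let s : ℕ → Letter := fun k => if Even k then Letter.a else Letter.b
  obtain ⟨t, ht, hto, hle⟩ := exists_blockWord_le_asLimAvg h s
  have hs_ne_a : ∃ᶠ k in atTop, s k ≠ Letter.a :=
    Nat.frequently_odd.mono fun k hk => by simp [s, Nat.not_even_iff_odd.2 hk]
  have hs_ne_b : ∃ᶠ k in atTop, s k ≠ Letter.b :=
    Nat.frequently_even.mono fun k hk => by simp [s, hk]
  exact ⟨blockWord t s, freqLang_blockWord_eq_zero ht hto hs_ne_a,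
    freqLang_blockWord_eq_zero ht hto hs_ne_b, hle⟩

theorem not_isAsLimAvg_freqLang_add : ¬ IsAsLimAvg (freqLang Letter.a + freqLang Letter.b) := by
  rintro ⟨A, hA⟩
  obtain ⟨w, ha, hb, hle⟩ := exists_freqLang_eq_zero_le_asLimAvg (A := A) fun u σ =>
    (hA ▸ freqLang_add_appendConst u σ).ge
  rw [hA, Pi.add_apply, ha, hb] at hle
  linarith

theorem mainTheorem8_general :
    (IsDLimAvg (freqLang Letter.a) ∧ IsDLimAvg (freqLang Letter.b)) ∧
    (IsAsLimAvg (freqLang Letter.a) ∧ IsAsLimAvg (freqLang Letter.b)) ∧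
    ¬ IsAsLimAvg (freqLang Letter.a + freqLang Letter.b) ∧
    ¬ ClosedUnderSum @IsAsLimAvg ∧
    (∀ (A : ProbWeightedAutomaton Letter) (c : ℝ),
      (∀ (u : List Letter) (σ : Letter), c ≤ A.asLimAvg (appendConst u σ)) →
      ∃ w : InfWord Letter,
        freqLang Letter.a w = 0 ∧ freqLang Letter.b w = 0 ∧ c ≤ A.asLimAvg w) :=
  have hD := isDLimAvg_freqLang
  ⟨⟨hD _, hD _⟩, ⟨(hD _).isAsLimAvg, (hD _).isAsLimAvg⟩, not_isAsLimAvg_freqLang_add,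
    fun hclosed => not_isAsLimAvg_freqLang_add
      (hclosed Letter _ _ (hD _).isAsLimAvg (hD _).isAsLimAvg),
    fun _ _ => exists_freqLang_eq_zero_le_asLimAvg⟩

end Sum

theorem mainTheorem8 :
    -- both frequency languages are definable, already by deterministic automata
    (IsDLimAvg (freqLang Letter.a) ∧ IsDLimAvg (freqLang Letter.b)) ∧
    (IsAsLimAvg (freqLang Letter.a) ∧ IsAsLimAvg (freqLang Letter.b)) ∧
    -- their sum is not
    ¬ IsAsLimAvg (freqLang Letter.a + freqLang Letter.b) ∧
    -- hence the class is not closed under sum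
    ¬ ClosedUnderSum @IsAsLimAvg ∧
    -- an automaton that is right on all words `u a a a …` and `u b b b …` fails as follows
    (∀ A : ProbWeightedAutomaton Letter,
      (∀ (u : List Letter) (σ : Letter), A.asLimAvg (appendConst u σ) = 1) →
      ∃ w : InfWord Letter,
        freqLang Letter.a w = 0 ∧ freqLang Letter.b w = 0 ∧ 1 / 6 ≤ A.asLimAvg w) := by
  obtain ⟨hD, hAs, hsum, hclosed, hword⟩ := mainTheorem8_general
  refine ⟨hD, hAs, hsum, hclosed, fun A hA => ?_⟩
  obtain ⟨w, ha, hb, hw⟩ := hword A 1 fun u σ => (hA u σ).ge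
  exact ⟨w, ha, hb, by linarith⟩
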